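/- Let $A$ be a unital $C^*$-algebra and let $S$ be a monoid which is left Ore (for all $s,t\in S$ there are $s',t'\in S$ with $s't=t's$) and left reversible (if $ts=us$ in $S$, then $s't=s'u$ for some $s'\in S$). Let $\alpha:S\to\mathrm{End}(A)$, $s\mapsto\alpha_s$, be a monoid homomorphism into the monoid of not necessarily unital $*$-endomorphisms of $A$, and suppose that every $\alpha_s$ is injective. Let $S^{\mathrm{op}}*_\alpha A*_\alpha S$ be the fractional skew monoid ring: the universal unital ring with a unital ring homomorphism $\phi_A:A\to S^{\mathrm{op}}*_\alpha A*_\alpha S$ and monoid homomorphisms $t\mapsto t_+$ from $S$ and $s\mapsto s_-$ from $S^{\mathrm{op}}$ such that, for all $a\in A$ and $s,t\in S$, $$t_+\phi_A(a)=\phi_A(\alpha_t(a))t_+,\qquad \phi_A(a)s_-=s_-\phi_A(\alpha_s(a)),\qquad s_-s_+=1,\qquad s_+s_-=\phi_A(\alpha_s(1)).$$ It is a complex $*$-algebra with scalars acting through $\phi_A$, $\phi_A(a)^*=\phi_A(a^*)$ and $(s_+)^*=s_-$. A covariant pair $(\pi,V)$ for $(A,S,\alpha)$ in a unital $*$-algebra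 $D$ consists of a unital $*$-homomorphism $\pi:A\to D$ and a monoid homomorphism $V:S\to D$ with $V_s^*V_s=1$ and $\pi(\alpha_s(a))=V_s\pi(a)V_s^*$ for all $s\in S$, $a\in A$; a covariant representation on a complex Hilbert space $H$ is a covariant pair in $B(H)$. A semigroup $C^*$-crossed product $A\times_\alpha S$ is a unital $C^*$-algebra with a covariant pair $(i_A,i_S)$ in it, such that the images of $i_A$ and $i_S$ generate it as a $C^*$-algebra and such that for every covariant representation $(\pi,V)$ on a Hilbert space there is a unital representation $\rho$ of $A\times_\alpha S$ with $\rho\circ i_A=\pi$ and $\rho\circ i_S=V$. Then $A\times_\alpha S$ exists, and $S^{\mathrm{op}}*_\alpha A*_\alpha S$ embeds in it as a dense $*$-subalgebra. Precisely: for every such crossed product there is a unique unital $*$-homomorphism $\varphi:S^{\mathrm{op}}*_\alpha A*_\alpha S\to A\times_\alpha S$ with $\varphi(\phi_A(a))=i_A(a)$ and $\varphi(s_+)=i_S(s)$ for all $a\in A$, $s\in S$, and $\varphi$ is injective with dense image. -/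

import Mathlib

/-- The left Ore condition for a monoid. -/
def LeftOre (S : Type*) [Monoid S] : Prop :=
  ∀ s t : S, ∃ s' t' : S, s' * t = t' * s

/-- Left reversibility: `t * s = u * s` implies `s' * t = s' * u` for some `s'`. -/
def LeftReversible (S : Type*) [Monoid S] : Prop :=
  ∀ t u s : S, t * s = u * s → ∃ s' : S, s' * t = s' * u

/-- Generators of the fractional skew monoid ring: `φ(a)`, `t₊` and `s₋`. -/
inductive FracSkewGen (A S : Type*) : Type _
  | coeff (a : A) : FracSkewGen A S
  | pos (t : S) : FracSkewGen A S
  | neg (s : S) : FracSkewGen A S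

section Skew

variable {A : Type*} [Ring A] [StarRing A] [Algebra ℂ A]
  {S : Type*} [Monoid S]

open FracSkewGen in
/-- Defining relations of `S^op *_α A *_α S`: `φ` is a unital ring homomorphism, `t ↦ t₊` is a
monoid homomorphism, `s ↦ s₋` is a monoid homomorphism from the opposite monoid, and the four
compatibility relations. -/
inductive FracSkewRel (α : S →* (A →⋆ₙₐ[ℂ] A)) :
    FreeRing (FracSkewGen A S) → FreeRing (FracSkewGen A S) → Prop
  | coeff_add (a b : A) :
      FracSkewRel α (.of (coeff (a + b))) (.of (coeff a) + .of (coeff b))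
  | coeff_mul (a b : A) :
      FracSkewRel α (.of (coeff (a * b))) (.of (coeff a) * .of (coeff b))
  | coeff_one : FracSkewRel α (.of (coeff 1)) 1
  | pos_mul (s t : S) : FracSkewRel α (.of (pos (s * t))) (.of (pos s) * .of (pos t))
  | pos_one : FracSkewRel α (.of (pos 1)) 1
  | neg_mul (s t : S) : FracSkewRel α (.of (neg (s * t))) (.of (neg t) * .of (neg s))
  | neg_one : FracSkewRel α (.of (neg 1)) 1
  | pos_coeff (t : S) (a : A) :
      FracSkewRel α (.of (pos t) * .of (coeff a)) (.of (coeff (α t a)) * .of (pos t))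
  | coeff_neg (s : S) (a : A) :
      FracSkewRel α (.of (coeff a) * .of (neg s)) (.of (neg s) * .of (coeff (α s a)))
  | neg_pos (s : S) : FracSkewRel α (.of (neg s) * .of (pos s)) 1
  | pos_neg (s : S) : FracSkewRel α (.of (pos s) * .of (neg s)) (.of (coeff (α s 1)))

/-- The fractional skew monoid ring `S^op *_α A *_α S`, the universal unital ring on the above
generators and relations. -/
def FracSkew (α : S →* (A →⋆ₙₐ[ℂ] A)) : Type _ := RingQuot (FracSkewRel α)

namespace FracSkew

variable (α : S →* (A →⋆ₙₐ[ℂ] A))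

noncomputable instance : Ring (FracSkew α) := inferInstanceAs (Ring (RingQuot (FracSkewRel α)))

/-- The quotient map from the free ring. -/
noncomputable def mk : FreeRing (FracSkewGen A S) →+* FracSkew α := RingQuot.mkRingHom _

theorem mk_rel {x y : FreeRing (FracSkewGen A S)} (h : FracSkewRel α x y) : mk α x = mk α y :=
  RingQuot.mkRingHom_rel h

/-- The structure map `φ : A → S^op *_α A *_α S`. -/
noncomputable def coeff : A →+* FracSkew α where
  toFun a := mk α (.of (.coeff a))
  map_one' := by rw [mk_rel α .coeff_one, map_one]
  map_mul' a b := by rw [mk_rel α (.coeff_mul a b), map_mul]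
  map_add' a b := by rw [mk_rel α (.coeff_add a b), map_add]
  map_zero' := by
    have h := mk_rel α (.coeff_add 0 0)
    rw [add_zero, map_add] at h
    exact left_eq_add.mp h

/-- The structure map `t ↦ t₊`. -/
noncomputable def pos : S →* FracSkew α where
  toFun t := mk α (.of (.pos t))
  map_one' := by rw [mk_rel α .pos_one, map_one]
  map_mul' s t := by rw [mk_rel α (.pos_mul s t), map_mul]

/-- The structure map `s ↦ s₋`, a monoid homomorphism on the opposite monoid. -/
noncomputable def neg : Sᵐᵒᵖ →* FracSkew α where
  toFun s := mk α (.of (.neg s.unop))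
  map_one' := by rw [MulOpposite.unop_one, mk_rel α .neg_one, map_one]
  map_mul' s t := by rw [MulOpposite.unop_mul, mk_rel α (.neg_mul _ _), map_mul]

theorem pos_mul_coeff (t : S) (a : A) : pos α t * coeff α a = coeff α (α t a) * pos α t := by
  have h := mk_rel α (.pos_coeff t a)
  rwa [map_mul, map_mul] at h

theorem coeff_mul_neg (s : S) (a : A) :
    coeff α a * neg α (.op s) = neg α (.op s) * coeff α (α s a) := by
  have h := mk_rel α (.coeff_neg s a)
  rwa [map_mul, map_mul] at h

theorem neg_mul_pos (s : S) : neg α (.op s) * pos α s = 1 := by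
  have h := mk_rel α (.neg_pos s)
  rwa [map_mul, map_one] at h

theorem pos_mul_neg (s : S) : pos α s * neg α (.op s) = coeff α (α s 1) := by
  have h := mk_rel α (.pos_neg s)
  rwa [map_mul] at h

variable {α}

theorem induction {P : FracSkew α → Prop} (hn : P (-1)) (hc : ∀ a, P (coeff α a))
    (hp : ∀ t, P (pos α t)) (hm : ∀ s, P (neg α (.op s)))
    (hadd : ∀ x y, P x → P y → P (x + y)) (hmul : ∀ x y, P x → P y → P (x * y))
    (x : FracSkew α) : P x := by
  obtain ⟨x, rfl⟩ := RingQuot.mkRingHom_surjective (FracSkewRel α) x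
  change P (mk α x)
  induction x using FreeRing.induction_on with
  | hn1 => rwa [map_neg, map_one]
  | hb b =>
    cases b with
    | coeff a => exact hc a
    | pos t => exact hp t
    | neg s => exact hm s
  | ha x y hx hy => rw [map_add]; exact hadd _ _ hx hy
  | hm x y hx hy => rw [map_mul]; exact hmul _ _ hx hy

theorem hom_ext {R : Type*} [Ring R] {f g : FracSkew α →+* R}
    (hc : ∀ a, f (coeff α a) = g (coeff α a)) (hp : ∀ t, f (pos α t) = g (pos α t))
    (hm : ∀ s, f (neg α (.op s)) = g (neg α (.op s))) : f = g := by
  ext x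
  induction x using FracSkew.induction with
  | hn => simp
  | hc a => exact hc a
  | hp t => exact hp t
  | hm s => exact hm s
  | hadd x y hx hy => rw [map_add, map_add, hx, hy]
  | hmul x y hx hy => rw [map_mul, map_mul, hx, hy]

/-- The universal property of `S^op *_α A *_α S`. -/
noncomputable def lift {R : Type*} [Ring R] (f : A →+* R) (p : S →* R) (m : Sᵐᵒᵖ →* R)
    (h1 : ∀ t a, p t * f a = f (α t a) * p t)
    (h2 : ∀ s a, f a * m (.op s) = m (.op s) * f (α s a))
    (h3 : ∀ s, m (.op s) * p s = 1) (h4 : ∀ s, p s * m (.op s) = f (α s 1)) :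
    FracSkew α →+* R :=
  RingQuot.lift ⟨FreeRing.lift fun g => match g with
    | .coeff a => f a
    | .pos t => p t
    | .neg s => m (.op s), by
      intro x y h
      induction h <;> simp [h1, h2, h3, h4]⟩

section
variable {R : Type*} [Ring R] (f : A →+* R) (p : S →* R) (m : Sᵐᵒᵖ →* R)
    (h1 : ∀ t a, p t * f a = f (α t a) * p t)
    (h2 : ∀ s a, f a * m (.op s) = m (.op s) * f (α s a))
    (h3 : ∀ s, m (.op s) * p s = 1) (h4 : ∀ s, p s * m (.op s) = f (α s 1))

theorem lift_coeff (a : A) : lift f p m h1 h2 h3 h4 (coeff α a) = f a := by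
  refine (RingQuot.lift_mkRingHom_apply _ _ _).trans ?_
  rw [FreeRing.lift_of]

theorem lift_pos (t : S) : lift f p m h1 h2 h3 h4 (pos α t) = p t := by
  refine (RingQuot.lift_mkRingHom_apply _ _ _).trans ?_
  rw [FreeRing.lift_of]

theorem lift_neg (s : S) : lift f p m h1 h2 h3 h4 (neg α (.op s)) = m (.op s) := by
  refine (RingQuot.lift_mkRingHom_apply _ _ _).trans ?_
  exact FreeRing.lift_of _ _

end

theorem scalar_commutes (c : ℂ) (x : FracSkew α) :
    coeff α (algebraMap ℂ A c) * x = x * coeff α (algebraMap ℂ A c) := by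
  have hα (s : S) : α s (algebraMap ℂ A c) = algebraMap ℂ A c * α s 1 := by
    rw [Algebra.algebraMap_eq_smul_one, map_smul, smul_one_mul]
  have hα' (s : S) : α s (algebraMap ℂ A c) = α s 1 * algebraMap ℂ A c := by
    rw [hα, Algebra.commutes]
  induction x using FracSkew.induction with
  | hn => simp
  | hc a => rw [← map_mul, ← map_mul, Algebra.commutes]
  | hp t =>
    rw [pos_mul_coeff, hα, map_mul, ← pos_mul_neg, mul_assoc, mul_assoc, neg_mul_pos, mul_one]
  | hm s =>
    rw [coeff_mul_neg, hα', map_mul, ← pos_mul_neg, ← mul_assoc, ← mul_assoc, neg_mul_pos,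
      one_mul]
  | hadd x y hx hy => rw [mul_add, add_mul, hx, hy]
  | hmul x y hx hy => rw [← mul_assoc, hx, mul_assoc, hy, mul_assoc]

/-- Complex scalars act through `φ`. -/
noncomputable instance : Algebra ℂ (FracSkew α) :=
  ((coeff α).comp (algebraMap ℂ A)).toAlgebra' fun c x => scalar_commutes c x

theorem smul_def' (c : ℂ) (x : FracSkew α) : c • x = coeff α (algebraMap ℂ A c) * x := rfl

/-- The involution as a homomorphism to the opposite ring:
`φ(a)* = φ(a*)`, `(t₊)* = t₋`, `(s₋)* = s₊`. -/
noncomputable def starHom : FracSkew α →+* (FracSkew α)ᵐᵒᵖ :=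
  lift ((coeff α).op.comp (starRingEquiv : A ≃+* Aᵐᵒᵖ).toRingHom)
    { toFun := fun t => .op (neg α (.op t))
      map_one' := by rw [MulOpposite.op_one, map_one, MulOpposite.op_one]
      map_mul' := fun s t => by rw [MulOpposite.op_mul, map_mul, MulOpposite.op_mul] }
    (pos α).op
    (fun t a => by
      change MulOpposite.op (coeff α (star a) * neg α (.op t)) =
        MulOpposite.op (neg α (.op t) * coeff α (star (α t a)))
      rw [coeff_mul_neg, map_star])
    (fun s a => by
      change MulOpposite.op (pos α s * coeff α (star a)) =
        MulOpposite.op (coeff α (star (α s a)) * pos α s)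
      rw [pos_mul_coeff, map_star])
    (fun s => congrArg MulOpposite.op (neg_mul_pos α s))
    (fun s => by
      change MulOpposite.op (pos α s * neg α (.op s)) =
        MulOpposite.op (coeff α (star (α s 1)))
      rw [pos_mul_neg, ← map_star (α s), star_one])

noncomputable instance : Star (FracSkew α) := ⟨fun x => (starHom x).unop⟩

theorem star_coeff (a : A) : star (coeff α a) = coeff α (star a) :=
  congrArg MulOpposite.unop (lift_coeff _ _ _ _ _ _ _ a)

theorem star_pos (t : S) : star (pos α t) = neg α (.op t) :=
  congrArg MulOpposite.unop (lift_pos _ _ _ _ _ _ _ t)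

theorem star_neg (s : S) : star (neg α (.op s)) = pos α s :=
  congrArg MulOpposite.unop (lift_neg _ _ _ _ _ _ _ s)

theorem star_add' (x y : FracSkew α) : star (x + y) = star x + star y :=
  congrArg MulOpposite.unop (map_add starHom x y)

theorem star_mul' (x y : FracSkew α) : star (x * y) = star y * star x :=
  congrArg MulOpposite.unop (map_mul starHom x y)

theorem star_neg_one : star (-1 : FracSkew α) = -1 := by
  change (starHom (-1)).unop = -1
  rw [map_neg, map_one, MulOpposite.unop_neg, MulOpposite.unop_one]

theorem star_star' (x : FracSkew α) : star (star x) = x := by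
  induction x using FracSkew.induction with
  | hn => rw [star_neg_one, star_neg_one]
  | hc a => rw [star_coeff, star_coeff, star_star]
  | hp t => rw [star_pos, star_neg]
  | hm s => rw [star_neg, star_pos]
  | hadd x y hx hy => rw [star_add', star_add', hx, hy]
  | hmul x y hx hy => rw [star_mul', star_mul', hx, hy]

noncomputable instance : StarRing (FracSkew α) where
  star_involutive := star_star'
  star_mul := star_mul'
  star_add := star_add'

instance [StarModule ℂ A] : StarModule ℂ (FracSkew α) where
  star_smul c x := by
    rw [smul_def', smul_def', star_mul, star_coeff, ← algebraMap_star_comm, scalar_commutes]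

end FracSkew

/-- A covariant pair for `(A, S, α)` in a unital *-algebra `D`: a unital *-homomorphism `π` and a
homomorphism `V` of `S` into the isometries of `D` with `π (α_s(a)) = V_s π(a) V_s*`. For
`D = H →L[ℂ] H` this is a covariant representation on the Hilbert space `H`. -/
structure IsCovariantPair {D : Type*} [Ring D] [StarRing D] [Algebra ℂ D]
    (α : S →* (A →⋆ₙₐ[ℂ] A)) (π : A →⋆ₐ[ℂ] D) (V : S →* D) : Prop where
  isometry : ∀ s, star (V s) * V s = 1
  covariant : ∀ s a, π (α s a) = V s * π a * star (V s)

end Skew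

universe u v w

/-- `B` with `iA : A → B` and `iS : S → B` is the semigroup C*-crossed product of `(A, S, α)`:
the pair is covariant, every covariant representation on a complex Hilbert space factors through
it, and `B` is generated as a C*-algebra by the two images. Hilbert spaces in the universe of
`A` and `S` suffice, as every covariant representation is a direct sum of cyclic ones and these
occur there. -/
structure IsCrossedProduct {A : Type u} [CStarAlgebra A] {S : Type v} [Monoid S]
    (α : S →* (A →⋆ₙₐ[ℂ] A)) {B : Type w} [CStarAlgebra B] (iA : A →⋆ₐ[ℂ] B) (iS : S →* B) :
    Prop where
  isCovariantPair : IsCovariantPair α iA iS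
  exists_rep : ∀ (H : Type (max u v)) [NormedAddCommGroup H] [InnerProductSpace ℂ H]
    [CompleteSpace H] (π : A →⋆ₐ[ℂ] (H →L[ℂ] H)) (V : S →* (H →L[ℂ] H)),
    IsCovariantPair α π V →
      ∃ ρ : B →⋆ₐ[ℂ] (H →L[ℂ] H), (∀ a, ρ (iA a) = π a) ∧ ∀ s, ρ (iS s) = V s
  generates :
    (StarAlgebra.adjoin ℂ (Set.range iA ∪ Set.range iS)).topologicalClosure = ⊤

/-! Everything rests on one fact: Hilbert space covariant representations separate the points of the
skew ring (`FracSkew.exists_covariantPair_ne_zero`). Given this, the supremum of the norms over all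
covariant representations, finite because the generators are uniformly bounded, is a C*-norm.
Completing in it gives a crossed product. For any crossed product, the canonical map is injective
because every covariant representation factors through it, and has dense image because the image
contains the generators.

To separate points, let `η : S → G` be the map to the group of left fractions. A nonzero element is
`s₋ ∑ φ(a_g) (t_g)₊` with one term for each `g` in the range of `η`, and some cut-down coefficient
`α_s(1) a_g α_{t_g}(1)` is nonzero. A generalized regular representation on `ℓ²(G, L)` reads off
this coefficient as a matrix entry, given representations `R_g` of `A` on `L` with `R_{η(s)g} ∘ α_s
= R_g` that do not kill it.

Such `R_g` come from bounded families in `A` indexed by `S`, modulo those vanishing on a tail `S u`: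
the coordinate at `r` is `α_q` where `η(q) g = η(r)`. Each `α_q` is isometric, so a nonzero element
keeps its norm on every tail. A state that vanishes on the tail ideal, followed by GNS, turns this
into operators. -/

/-! ### The group of left fractions. -/

/-- A left Ore, left reversible monoid has a group of left fractions. -/
theorem exists_group_of_left_fractions {S : Type u} [Monoid S] (hOre : LeftOre S)
    (hrev : LeftReversible S) :
    ∃ (G : Type u) (_ : Group G) (η : S →* G),
      (∀ t u, η t = η u → ∃ w, w * t = w * u) ∧ ∀ g, ∃ x y, η x * g = η y := by
  let _ : OreLocalization.OreSet (⊤ : Submonoid S) :=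
    { ore_right_cancel := fun r₁ r₂ s h => by
        obtain ⟨w, hw⟩ := hrev r₁ r₂ s h
        exact ⟨⟨w, trivial⟩, hw⟩
      oreNum := fun r s => (hOre s r).choose_spec.choose
      oreDenom := fun r s => ⟨(hOre s r).choose, trivial⟩
      ore_eq := fun r s => (hOre s r).choose_spec.choose_spec }
  let i : S →* (⊤ : Submonoid S) := (Submonoid.topEquiv (M := S)).symm.toMonoidHom
  -- The unit group of the localization at all of `S` serves as `G`: it contains the image of `S`,
  -- and the value of any unit is a fraction `s⁻¹ r`.
  let η : S →* (OreLocalization (⊤ : Submonoid S) S)ˣ :=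
    Units.liftRight OreLocalization.numeratorHom
      (fun s => OreLocalization.numeratorUnit (i s)) (fun s => rfl)
  have hη (s : S) : (η s : OreLocalization (⊤ : Submonoid S) S) = OreLocalization.oreDiv s 1 := rfl
  refine ⟨_, inferInstance, η, fun t u h => ?_, fun g => ?_⟩
  · have h' := congrArg Units.val h
    rw [hη, hη, OreLocalization.oreDiv_eq_iff] at h'
    obtain ⟨a, b, h1, h2⟩ := h'
    have hab : (a : S) = b := by simpa using h2
    refine ⟨b, ?_⟩
    rw [← hab]
    have := h1.symm
    rw [← hab] at this
    exact this
  · obtain ⟨g, g', h1, h2⟩ := g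
    induction g using OreLocalization.ind with
    | _ r s =>
      refine ⟨s, r, Units.ext ?_⟩
      change OreLocalization.oreDiv (s : S) 1 * OreLocalization.oreDiv r s =
        OreLocalization.oreDiv r 1
      exact OreLocalization.mul_cancel

/-! ### Normal form of elements of the skew ring. -/

namespace FracSkew

section NormalForm

variable {A : Type*} [Ring A] [StarRing A] [Algebra ℂ A] {S : Type*} [Monoid S]
  {α : S →* (A →⋆ₙₐ[ℂ] A)}

theorem neg_mul' (s t : S) : neg α (.op (s * t)) = neg α (.op t) * neg α (.op s) := by
  rw [MulOpposite.op_mul, map_mul]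

/-- Since `w₊` has the left inverse `w₋`, it can be cancelled on the left. Hence `t₊` depends only
on `η t`. -/
theorem pos_congr {t u w : S} (h : w * t = w * u) : pos α t = pos α u := by
  have h' := congrArg (neg α (.op w) * pos α ·) h
  simpa only [map_mul, ← mul_assoc, neg_mul_pos, one_mul] using h'

/-- Sums `∑ φ(a) t₊` over representatives `t` of the elements in the range of `η`. -/
noncomputable def rangeSum (α : S →* (A →⋆ₙₐ[ℂ] A)) {G : Type*} [Group G] (η : S →* G) :
    (Set.range η →₀ A) →+ FracSkew α :=
  Finsupp.liftAddHom fun g => (AddMonoidHom.mulRight (pos α g.2.choose)).comp (coeff α).toAddMonoidHom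

variable {G : Type*} [Group G] {η : S →* G}

theorem rangeSum_single (g : Set.range η) (a : A) :
    rangeSum α η (Finsupp.single g a) = coeff α a * pos α g.2.choose := by
  simp [rangeSum]

theorem coeff_mul_pos_mem (hη : ∀ t u, η t = η u → ∃ w, w * t = w * u) (a : A) (t : S) :
    coeff α a * pos α t ∈ (rangeSum α η).range := by
  refine ⟨Finsupp.single ⟨η t, t, rfl⟩ a, ?_⟩
  rw [rangeSum_single]
  have h : η (⟨η t, t, rfl⟩ : Set.range η).2.choose = η t :=
    (⟨η t, t, rfl⟩ : Set.range η).2.choose_spec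
  obtain ⟨w, hw⟩ := hη _ _ h
  rw [pos_congr (α := α) hw]

theorem mul_mem_range (hη : ∀ t u, η t = η u → ∃ w, w * t = w * u) (b : A) (r : S)
    {y : FracSkew α} (hy : y ∈ (rangeSum α η).range) :
    coeff α b * pos α r * y ∈ (rangeSum α η).range := by
  obtain ⟨f, rfl⟩ := hy
  induction f using Finsupp.induction_linear with
  | zero => rw [map_zero, mul_zero]; exact zero_mem _
  | add f g hf hg => rw [map_add, mul_add]; exact add_mem hf hg
  | single g a =>
    rw [rangeSum_single, ← mul_assoc, mul_assoc (coeff α b), pos_mul_coeff, ← mul_assoc, ← map_mul,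
      mul_assoc, ← map_mul]
    exact coeff_mul_pos_mem hη _ _

theorem pos_mul_mem_range (hη : ∀ t u, η t = η u → ∃ w, w * t = w * u) (r : S)
    {y : FracSkew α} (hy : y ∈ (rangeSum α η).range) : pos α r * y ∈ (rangeSum α η).range := by
  simpa using mul_mem_range hη 1 r hy

theorem coeff_mul_mem_range (hη : ∀ t u, η t = η u → ∃ w, w * t = w * u) (b : A)
    {y : FracSkew α} (hy : y ∈ (rangeSum α η).range) : coeff α b * y ∈ (rangeSum α η).range := by
  simpa using mul_mem_range hη b 1 hy

/-- Every element is of the form `s₋ ∑ φ(a) t₊`. -/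
theorem exists_eq_neg_mul_rangeSum (hOre : LeftOre S)
    (hη : ∀ t u, η t = η u → ∃ w, w * t = w * u) (x : FracSkew α) :
    ∃ s f, x = neg α (.op s) * rangeSum α η f := by
  -- The elements of the desired form contain `1`, so it is enough that left multiplication by each
  -- `x` preserves them; this can be checked on generators.
  suffices h : ∀ x y : FracSkew α, (∃ s, ∃ z ∈ (rangeSum α η).range, y = neg α (.op s) * z) →
      ∃ s, ∃ z ∈ (rangeSum α η).range, x * y = neg α (.op s) * z by
    obtain ⟨s, _, ⟨f, rfl⟩, hz⟩ := h x 1 ⟨1, 1, by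
      simpa using coeff_mul_pos_mem (α := α) hη 1 1, by simp⟩
    exact ⟨s, f, by rwa [mul_one] at hz⟩
  clear x
  intro x
  induction x using FracSkew.induction with
  | hn =>
    rintro _ ⟨s, z, hz, rfl⟩
    exact ⟨s, -z, neg_mem hz, by simp⟩
  | hc a =>
    rintro _ ⟨s, z, hz, rfl⟩
    exact ⟨s, coeff α (α s a) * z, coeff_mul_mem_range hη _ hz, by
      rw [← mul_assoc, coeff_mul_neg, mul_assoc]⟩
  | hp t =>
    rintro _ ⟨s, z, hz, rfl⟩
    -- From `w t = w' s`: `t₊ s₋ = w₋ (w t)₊ s₋ = w₋ w'₊ s₊ s₋ = w₋ w'₊ φ(α_s(1))`.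
    obtain ⟨w, w', h⟩ := hOre s t
    refine ⟨w, pos α w' * (coeff α (α s 1) * z),
      pos_mul_mem_range hη _ (coeff_mul_mem_range hη _ hz), ?_⟩
    rw [← pos_mul_neg, ← mul_assoc, ← mul_assoc, ← mul_assoc, ← mul_assoc, mul_assoc _ _ (pos α s),
      ← map_mul, ← h, map_mul, ← mul_assoc, neg_mul_pos, one_mul]
  | hm r =>
    rintro _ ⟨s, z, hz, rfl⟩
    exact ⟨s * r, z, hz, by rw [neg_mul', mul_assoc]⟩
  | hadd x x' hx hx' =>
    intro y hy
    obtain ⟨s, z, hz, h⟩ := hx y hy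
    obtain ⟨s', z', hz', h'⟩ := hx' y hy
    -- A common denominator `w s = w' s'`, used with `s₋ = (w s)₋ w₊`.
    obtain ⟨w, w', hw⟩ := hOre s' s
    refine ⟨w * s, pos α w * z + pos α w' * z',
      add_mem (pos_mul_mem_range hη _ hz) (pos_mul_mem_range hη _ hz'), ?_⟩
    rw [add_mul, h, h', mul_add]
    congr 1
    · rw [neg_mul', mul_assoc, ← mul_assoc _ (pos α w), neg_mul_pos, one_mul]
    · rw [hw, neg_mul', mul_assoc, ← mul_assoc _ (pos α w'), neg_mul_pos, one_mul]
  | hmul x x' hx hx' =>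
    intro y hy
    rw [mul_assoc]
    exact hx _ (hx' y hy)

end NormalForm

/-! ### Covariant pairs as *-homomorphisms on the skew ring. -/

section OfPair

variable {A : Type*} [Ring A] [StarRing A] [Algebra ℂ A] {S : Type*} [Monoid S]
  {α : S →* (A →⋆ₙₐ[ℂ] A)} {D : Type*} [Ring D] [StarRing D] [Algebra ℂ D]

variable {π : A →⋆ₐ[ℂ] D} {V : S →* D}

theorem _root_.IsCovariantPair.mul_map (h : IsCovariantPair α π V) (t : S) (a : A) :
    V t * π a = π (α t a) * V t := by
  rw [h.covariant, mul_assoc, h.isometry, mul_one]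

theorem _root_.IsCovariantPair.map_mul_star (h : IsCovariantPair α π V) (s : S) (a : A) :
    π a * star (V s) = star (V s) * π (α s a) := by
  have := congrArg star (h.mul_map s (star a))
  simpa only [star_mul, ← map_star, star_star] using this

theorem _root_.IsCovariantPair.mul_star_self (h : IsCovariantPair α π V) (s : S) :
    V s * star (V s) = π (α s 1) := by
  rw [h.covariant, map_one π, mul_one]

/-- The ring homomorphism on `S^op *_α A *_α S` given by a covariant pair. -/
noncomputable def ofPairRingHom (h : IsCovariantPair α π V) : FracSkew α →+* D :=
  lift (π : A →+* D) V
    { toFun := fun s => star (V s.unop)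
      map_one' := by simp
      map_mul' := by simp }
    h.mul_map h.map_mul_star h.isometry h.mul_star_self

theorem ofPairRingHom_coeff (h : IsCovariantPair α π V) (a : A) :
    ofPairRingHom h (coeff α a) = π a :=
  lift_coeff _ _ _ h.mul_map h.map_mul_star h.isometry h.mul_star_self a

theorem ofPairRingHom_pos (h : IsCovariantPair α π V) (s : S) :
    ofPairRingHom h (pos α s) = V s :=
  lift_pos _ _ _ h.mul_map h.map_mul_star h.isometry h.mul_star_self s

theorem ofPairRingHom_neg (h : IsCovariantPair α π V) (s : S) :
    ofPairRingHom h (neg α (.op s)) = star (V s) :=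
  lift_neg _ _ _ h.mul_map h.map_mul_star h.isometry h.mul_star_self s

/-- The *-homomorphism on `S^op *_α A *_α S` given by a covariant pair. -/
noncomputable def ofPair (h : IsCovariantPair α π V) : FracSkew α →⋆ₐ[ℂ] D :=
  { ofPairRingHom h with
    commutes' := fun c => (ofPairRingHom_coeff h _).trans (AlgHomClass.commutes π c)
    map_star' := fun x => by
      change ofPairRingHom h (star x) = star (ofPairRingHom h x)
      induction x using FracSkew.induction with
      | hn => rw [star_neg_one, map_neg, map_one, _root_.star_neg, star_one]
      | hc a => rw [star_coeff, ofPairRingHom_coeff, ofPairRingHom_coeff, map_star]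
      | hp t => rw [star_pos, ofPairRingHom_neg, ofPairRingHom_pos]
      | hm s => rw [FracSkew.star_neg, ofPairRingHom_neg, ofPairRingHom_pos, star_star]
      | hadd x y hx hy => rw [star_add, map_add, map_add, star_add, hx, hy]
      | hmul x y hx hy => rw [star_mul, map_mul, map_mul, star_mul, hx, hy] }

theorem ofPair_coeff (h : IsCovariantPair α π V) (a : A) : ofPair h (coeff α a) = π a :=
  ofPairRingHom_coeff h a

theorem ofPair_pos (h : IsCovariantPair α π V) (s : S) : ofPair h (pos α s) = V s :=
  ofPairRingHom_pos h s

theorem ofPair_neg (h : IsCovariantPair α π V) (s : S) :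
    ofPair h (neg α (.op s)) = star (V s) :=
  ofPairRingHom_neg h s

theorem starAlgHom_ext {f g : FracSkew α →⋆ₐ[ℂ] D} (hc : ∀ a, f (coeff α a) = g (coeff α a))
    (hp : ∀ s, f (pos α s) = g (pos α s)) : f = g := by
  have := hom_ext (f := (f : FracSkew α →+* D)) (g := (g : FracSkew α →+* D)) hc hp fun s => by
    change f _ = g _
    rw [← star_pos, map_star, map_star, hp]
  ext x
  exact congrArg (fun k : FracSkew α →+* D => k x) this

theorem isCovariantPair_of_starAlgHom (f : FracSkew α →⋆ₐ[ℂ] D) (π : A →⋆ₐ[ℂ] D) (V : S →* D)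
    (hc : ∀ a, f (coeff α a) = π a) (hp : ∀ s, f (pos α s) = V s) : IsCovariantPair α π V where
  isometry s := by rw [← hp, ← map_star, star_pos, ← map_mul, neg_mul_pos, map_one]
  covariant s a := by
    rw [← hp, ← hc, ← hc, ← map_star, star_pos, ← map_mul, ← map_mul, pos_mul_coeff, mul_assoc,
      pos_mul_neg, ← map_mul, ← map_mul, mul_one]

end OfPair

end FracSkew

/-! ### Weighted permutation operators on `ℓ²(G, L)`. -/

section WeightedPermutation

open scoped ENNReal

variable {G L : Type*} [NormedAddCommGroup L] [InnerProductSpace ℂ L]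

theorem memℓp_weighted_perm (e : Equiv.Perm G) (T : G → L →L[ℂ] L) {C : ℝ}
    (hT : ∀ g, ‖T g‖ ≤ C) (ξ : lp (fun _ : G => L) 2) : Memℓp (fun g => T g (ξ (e g))) 2 := by
  have h2 : 0 < (2 : ℝ≥0∞).toReal := by norm_num
  have h := (e.summable_iff (f := fun g => ‖ξ g‖ ^ (2 : ℝ≥0∞).toReal)).2 ((lp.memℓp ξ).summable h2)
  refine memℓp_gen (Summable.of_nonneg_of_le (fun g => by positivity) (fun g => ?_)
    (h.mul_left (C ^ (2 : ℝ≥0∞).toReal)))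
  have hC : 0 ≤ C := (norm_nonneg _).trans (hT g)
  rw [Function.comp_apply, ← Real.mul_rpow hC (norm_nonneg _)]
  exact Real.rpow_le_rpow (norm_nonneg _) ((T g).le_of_opNorm_le (hT g) _) h2.le

/-- The operator `ξ ↦ (g ↦ T g (ξ (e g)))` on `ℓ²(G, L)`. -/
noncomputable def weightedPerm (e : Equiv.Perm G) (T : G → L →L[ℂ] L) {C : ℝ}
    (hT : ∀ g, ‖T g‖ ≤ C) : lp (fun _ : G => L) 2 →L[ℂ] lp (fun _ : G => L) 2 :=
  LinearMap.mkContinuous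
    { toFun := fun ξ => ⟨fun g => T g (ξ (e g)), memℓp_weighted_perm e T hT ξ⟩
      map_add' := fun ξ ζ => by ext g; exact map_add (T g) _ _
      map_smul' := fun c ξ => by ext g; exact map_smul (T g) _ _ }
    -- If `G` is empty, `hT` does not force `0 ≤ C`.
    (max C 0) fun ξ => by
      have h2 : 0 < (2 : ℝ≥0∞).toReal := by norm_num
      refine lp.norm_le_of_forall_sum_le h2 (by positivity) fun s => ?_
      rw [Real.mul_rpow (by positivity) (norm_nonneg _)]
      calc ∑ g ∈ s, ‖T g (ξ (e g))‖ ^ (2 : ℝ≥0∞).toReal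
          ≤ ∑ g ∈ s, (max C 0) ^ (2 : ℝ≥0∞).toReal * ‖ξ (e g)‖ ^ (2 : ℝ≥0∞).toReal := by
            refine Finset.sum_le_sum fun g _ => ?_
            rw [← Real.mul_rpow (by positivity) (norm_nonneg _)]
            exact Real.rpow_le_rpow (norm_nonneg _)
              ((T g).le_of_opNorm_le ((hT g).trans (le_max_left _ _)) _) h2.le
        _ = (max C 0) ^ (2 : ℝ≥0∞).toReal *
              ∑ g ∈ s.map e.toEmbedding, ‖ξ g‖ ^ (2 : ℝ≥0∞).toReal := by
            rw [← Finset.mul_sum, Finset.sum_map]; rfl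
        _ ≤ _ := by
            gcongr
            exact lp.sum_rpow_le_norm_rpow h2 ξ _

end WeightedPermutation

/-! ### The regular representation of a covariant family. -/

namespace RegularRep

variable {A : Type*} [CStarAlgebra A] {S : Type*} [Monoid S]
  {G L : Type*} [NormedAddCommGroup L] [InnerProductSpace ℂ L] [CompleteSpace L]
  (R : G → A →⋆ₙₐ[ℂ] (L →L[ℂ] L))

/-- The subspace of `ξ ∈ ℓ²(G, L)` with `ξ g` in the range of the projection `R g 1`. -/
noncomputable def space : Submodule ℂ (lp (fun _ : G => L) 2) where
  carrier := {ξ | ∀ g, R g 1 (ξ g) = ξ g}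
  add_mem' {ξ ζ} hξ hζ g := by
    rw [lp.coeFn_add, Pi.add_apply, map_add, hξ, hζ]
  zero_mem' g := by rw [lp.coeFn_zero, Pi.zero_apply, map_zero]
  smul_mem' c ξ hξ g := by rw [lp.coeFn_smul, Pi.smul_apply, map_smul, hξ]

variable {R} in
theorem mem_space {ξ : lp (fun _ : G => L) 2} : ξ ∈ space R ↔ ∀ g, R g 1 (ξ g) = ξ g := Iff.rfl

theorem isClosed_space : IsClosed (space R : Set (lp (fun _ : G => L) 2)) := by
  have h : (space R : Set (lp (fun _ : G => L) 2)) = ⋂ g, {ξ | R g 1 (ξ g) = ξ g} := by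
    ext ξ
    simp [mem_space]
  rw [h]
  refine isClosed_iInter fun g => isClosed_eq ?_ ?_
  · exact (R g 1).continuous.comp (lp.lipschitzWith_one_eval 2 g).continuous
  · exact (lp.lipschitzWith_one_eval 2 g).continuous

instance : CompleteSpace (space R) := (isClosed_space R).completeSpace_coe

variable {R}

/-- The restriction to `space R` of `ξ ↦ (g ↦ T g (ξ (e g)))`. -/
noncomputable def op (e : Equiv.Perm G) (T : G → L →L[ℂ] L) {C : ℝ} (hT : ∀ g, ‖T g‖ ≤ C)
    (h : ∀ g ξ, R (e g) 1 ξ = ξ → R g 1 (T g ξ) = T g ξ) : space R →L[ℂ] space R :=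
  ((weightedPerm e T hT).comp (space R).subtypeL).codRestrict _ fun ξ g => h g _ (ξ.2 (e g))

theorem op_apply (e : Equiv.Perm G) (T : G → L →L[ℂ] L) {C : ℝ} (hT : ∀ g, ‖T g‖ ≤ C)
    (h : ∀ g ξ, R (e g) 1 ξ = ξ → R g 1 (T g ξ) = T g ξ) (ξ : space R) (g : G) :
    (op e T hT h ξ).1 g = T g (ξ.1 (e g)) := rfl

theorem space_ext {ξ ζ : space R} (h : ∀ g, ξ.1 g = ζ.1 g) : ξ = ζ :=
  Subtype.ext (lp.ext (funext h))

theorem inner_eq (ξ ζ : space R) : inner ℂ ξ ζ = ∑' g, inner ℂ (ξ.1 g) (ζ.1 g) :=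
  lp.inner_eq_tsum _ _

theorem apply_mul (g : G) (a b : A) (ξ : L) : R g (a * b) ξ = R g a (R g b ξ) := by
  rw [map_mul]; rfl

theorem inner_apply_left (g : G) (a : A) (ξ ζ : L) :
    inner ℂ (R g (star a) ξ) ζ = inner ℂ ξ (R g a ζ) := by
  rw [map_star, ContinuousLinearMap.star_eq_adjoint, ContinuousLinearMap.adjoint_inner_left]

theorem norm_apply_le (g : G) (a : A) : ‖R g a‖ ≤ ‖a‖ :=
  NonUnitalStarAlgHom.norm_apply_le (R g) a

/-- The representation of `A` by the diagonal operators. -/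
noncomputable def diag (R : G → A →⋆ₙₐ[ℂ] (L →L[ℂ] L)) : A →⋆ₐ[ℂ] (space R →L[ℂ] space R) where
  toFun a := op 1 (fun g => R g a) (fun g => norm_apply_le g a) fun g ξ _ => by
    rw [← apply_mul, one_mul]
  map_one' := ContinuousLinearMap.ext fun ξ => space_ext fun g => ξ.2 g
  map_mul' a b := ContinuousLinearMap.ext fun ξ => space_ext fun g => apply_mul g a b _
  map_zero' := ContinuousLinearMap.ext fun ξ => space_ext fun g => by
    rw [op_apply, map_zero]; rfl
  map_add' a b := ContinuousLinearMap.ext fun ξ => space_ext fun g => by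
    rw [op_apply, map_add]; rfl
  commutes' c := ContinuousLinearMap.ext fun ξ => space_ext fun g => by
    rw [op_apply, Algebra.algebraMap_eq_smul_one, map_smul, Equiv.Perm.one_apply,
      smul_apply, ξ.2 g]
    rfl
  map_star' a := by
    rw [ContinuousLinearMap.star_eq_adjoint, ContinuousLinearMap.eq_adjoint_iff]
    intro ξ ζ
    rw [inner_eq, inner_eq]
    exact tsum_congr fun g => inner_apply_left g a _ _

theorem diag_apply (a : A) (ξ : space R) (g : G) : (diag R a ξ).1 g = R g a (ξ.1 g) := rfl

/-- The vector `δ_g ⊗ R g 1 ζ`. -/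
noncomputable def single [DecidableEq G] (R : G → A →⋆ₙₐ[ℂ] (L →L[ℂ] L)) (g : G) (ζ : L) :
    space R :=
  ⟨lp.single 2 g (R g 1 ζ), fun k => by
    rcases eq_or_ne k g with rfl | hk
    · rw [lp.single_apply_self, ← apply_mul, one_mul]
    · rw [lp.single_apply_ne _ _ _ hk, map_zero]⟩

theorem single_apply_self [DecidableEq G] (g : G) (ζ : L) : (single R g ζ).1 g = R g 1 ζ :=
  lp.single_apply_self 2 g _

theorem single_apply_ne [DecidableEq G] {g k : G} (ζ : L) (h : k ≠ g) :
    (single R g ζ).1 k = 0 :=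
  lp.single_apply_ne 2 g _ h

variable [Group G] {α : S →* (A →⋆ₙₐ[ℂ] A)} {η : S →* G}
  (hR : ∀ s g a, R (η s * g) (α s a) = R g a)

include hR in
theorem apply_inv (s : S) (g : G) (a : A) : R ((η s)⁻¹ * g) a = R g (α s a) := by
  rw [← hR s, mul_inv_cancel_left]

/-- The isometries `(V s ξ) g = ξ (s⁻¹ g)`. -/
noncomputable def shift : S →* (space R →L[ℂ] space R) where
  toFun s := op (Equiv.mulLeft (η s)⁻¹) (fun _ => 1) (C := 1)
    (fun _ => ContinuousLinearMap.norm_id_le) fun g ξ h => by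
      change R ((η s)⁻¹ * g) 1 ξ = ξ at h
      rw [one_apply_eq_self, ← h, apply_inv hR, ← apply_mul, one_mul]
  map_one' := ContinuousLinearMap.ext fun ξ => space_ext fun g => by
    rw [op_apply]; simp
  map_mul' s t := ContinuousLinearMap.ext fun ξ => space_ext fun g => by
    rw [mul_apply_eq_comp, op_apply, op_apply, op_apply]
    simp [mul_assoc]

theorem shift_apply (s : S) (ξ : space R) (g : G) :
    (shift hR s ξ).1 g = ξ.1 ((η s)⁻¹ * g) := rfl

/-- The fibre at `η s * g` contains the one at `g`, because `R g 1 = R (η s * g) (α s 1)`. The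
adjoint therefore translates back and then projects onto the smaller fibre. -/
theorem star_shift_apply (s : S) (ξ : space R) (g : G) :
    (star (shift hR s) ξ).1 g = R g 1 (ξ.1 (η s * g)) := by
  have h : op (Equiv.mulLeft (η s)) (fun g => R g 1) (fun g => norm_apply_le g 1)
      (fun g ξ _ => by rw [← apply_mul, one_mul]) = star (shift hR s) := by
    rw [ContinuousLinearMap.star_eq_adjoint, ContinuousLinearMap.eq_adjoint_iff]
    intro ξ ζ
    rw [inner_eq, inner_eq]
    refine Eq.trans (tsum_congr fun g => ?_) ((Equiv.mulLeft (η s)).tsum_eq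
      fun g => inner ℂ (ξ.1 g) ((shift hR s ζ).1 g))
    rw [op_apply, shift_apply, Equiv.coe_mulLeft, inv_mul_cancel_left]
    have := inner_apply_left (R := R) g 1 (ξ.1 (η s * g)) (ζ.1 g)
    rw [star_one, ζ.2 g] at this
    exact this
  rw [← h, op_apply]
  rfl

theorem isCovariantPair : IsCovariantPair α (diag R) (shift hR) where
  isometry s := ContinuousLinearMap.ext fun ξ => space_ext fun g => by
    rw [mul_apply_eq_comp, star_shift_apply, shift_apply, inv_mul_cancel_left, ξ.2 g]
    rfl
  covariant s a := ContinuousLinearMap.ext fun ξ => space_ext fun g => by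
    rw [mul_apply_eq_comp, mul_apply_eq_comp, shift_apply, diag_apply,
      diag_apply, star_shift_apply, mul_inv_cancel_left, ← apply_mul, mul_one, apply_inv hR]

end RegularRep

/-! ### States vanishing on an ideal, and their GNS representations. -/

open scoped ComplexOrder in
/-- A functional of norm at most one that preserves the unit is positive. -/
theorem nonneg_apply_of_norm_le_one {W : Type*} [CStarAlgebra W] [PartialOrder W]
    [StarOrderedRing W] (f : W →L[ℂ] ℂ) (hf : ‖f‖ ≤ 1) (h1 : f 1 = 1) {a : W} (ha : 0 ≤ a) :
    0 ≤ f a := by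
  have hnt : Nontrivial W := ⟨⟨1, 0, fun h => by simp [h] at h1⟩⟩
  have hsa : star a = a := (IsSelfAdjoint.of_nonneg ha).star_eq
  -- The C*-identity for `a + it` bounds its norm squared by `‖a‖² + t²`. This grows too slowly in
  -- `t` to allow a nonzero imaginary part of `f a`.
  have him (t : ℝ) : ((f a).im + t) ^ 2 ≤ ‖a‖ ^ 2 + t ^ 2 := by
    have hn : ‖a + algebraMap ℂ W (Complex.I * t)‖ ^ 2 ≤ ‖a‖ ^ 2 + t ^ 2 := by
      have hm : star (a + algebraMap ℂ W (Complex.I * t)) * (a + algebraMap ℂ W (Complex.I * t)) =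
          star a * a + algebraMap ℂ W ((t ^ 2 : ℝ) : ℂ) := by
        rw [star_add, hsa, ← algebraMap_star_comm, add_mul, mul_add, mul_add,
          ← Algebra.commutes (Complex.I * t) a, ← map_mul]
        have e1 : (starRingEnd ℂ) (Complex.I * t) = - (Complex.I * t) := by simp
        have e2 : - (Complex.I * t) * (Complex.I * t) = ((t ^ 2 : ℝ) : ℂ) := by
          push_cast
          linear_combination (-(t : ℂ) ^ 2) * Complex.I_sq
        rw [Complex.star_def, e1, e2, map_neg]
        noncomm_ring
      rw [sq, ← CStarRing.norm_star_mul_self, hm]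
      refine (norm_add_le _ _).trans ?_
      rw [CStarRing.norm_star_mul_self, norm_algebraMap', Complex.norm_real, Real.norm_eq_abs,
        abs_of_nonneg (by positivity), sq ‖a‖]
    have hfa : f (a + algebraMap ℂ W (Complex.I * t)) = f a + Complex.I * t := by
      rw [map_add, Algebra.algebraMap_eq_smul_one, map_smul, h1, smul_eq_mul, mul_one]
    have hb : ‖f a + Complex.I * t‖ ^ 2 ≤ ‖a + algebraMap ℂ W (Complex.I * t)‖ ^ 2 := by
      rw [← hfa]
      gcongr
      simpa using f.le_of_opNorm_le hf (a + algebraMap ℂ W (Complex.I * t))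
    refine le_trans ?_ (hb.trans hn)
    have := Complex.abs_im_le_norm (f a + Complex.I * t)
    rw [← sq_abs]
    gcongr
    simpa using this
  have him0 : (f a).im = 0 := by
    by_contra h
    -- With this `t` the cross term `2 t Im f(a)` equals `‖a‖² + 1`, which is too large.
    have := him ((‖a‖ ^ 2 + 1) / (2 * (f a).im))
    have e : 2 * (f a).im * ((‖a‖ ^ 2 + 1) / (2 * (f a).im)) = ‖a‖ ^ 2 + 1 := by field_simp
    nlinarith [sq_nonneg (f a).im]
  have hre : 0 ≤ (f a).re := by
    -- From `0 ≤ ‖a‖ - a ≤ ‖a‖`. Applying `f` then gives `‖a‖ - Re f(a) ≤ ‖a‖`.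
    have hle : ‖algebraMap ℝ W ‖a‖ - a‖ ≤ ‖a‖ := by
      have h0 : 0 ≤ algebraMap ℝ W ‖a‖ - a :=
        sub_nonneg.2 (IsSelfAdjoint.le_algebraMap_norm_self (.of_nonneg ha))
      have h2 : algebraMap ℝ W ‖a‖ - a ≤ algebraMap ℝ W ‖a‖ := sub_le_self _ ha
      refine (CStarAlgebra.norm_le_norm_of_nonneg_of_le h0 h2).trans ?_
      rw [norm_algebraMap', norm_norm]
    have hfa : f (algebraMap ℝ W ‖a‖ - a) = ‖a‖ - f a := by
      rw [map_sub, IsScalarTower.algebraMap_apply ℝ ℂ W, Algebra.algebraMap_eq_smul_one (A := W),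
        map_smul, h1, smul_eq_mul, mul_one]
      rfl
    have h3 := (f.le_of_opNorm_le hf (algebraMap ℝ W ‖a‖ - a)).trans_eq (one_mul _)
    rw [hfa] at h3
    have h4 := (Complex.re_le_norm _).trans (h3.trans hle)
    rw [Complex.sub_re, Complex.ofReal_re] at h4
    linarith
  exact Complex.nonneg_iff.2 ⟨hre, him0.symm⟩

theorem one_add_norm_le_norm_one_add {W : Type*} [CStarAlgebra W] [PartialOrder W]
    [StarOrderedRing W] [Nontrivial W] {a : W} (ha : 0 ≤ a) : 1 + ‖a‖ ≤ ‖1 + a‖ := by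
  have h := CStarAlgebra.norm_mem_spectrum_of_nonneg ha
  have h2 : 1 + ‖a‖ ∈ spectrum ℝ (1 + a) := by
    have := spectrum.add_mem_add_iff (R := ℝ) (r := ‖a‖) (a := a) (s := 1)
    rw [map_one, add_comm ‖a‖] at this
    exact this.2 h
  have h3 := spectrum.norm_le_norm_of_mem h2
  rwa [Real.norm_of_nonneg (by positivity)] at h3

/-- By Hahn–Banach, a functional of norm at most one attains the seminorm of the class of `1 + c`
modulo `J`, which is at least `1 + ‖c‖`. As `|f 1| ≤ 1` and `|f c| ≤ ‖c‖`, both bounds are attained;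
so `f 1 = 1` and `f` is positive. -/
theorem exists_state_of_le_norm {W : Type*} [CStarAlgebra W] [PartialOrder W]
    [StarOrderedRing W] [Nontrivial W] (J : Submodule ℂ W) {c : W}
    (hJ : ∀ j ∈ J, 1 + ‖c‖ ≤ ‖1 + c + j‖) :
    ∃ f : W →L[ℂ] ℂ, (∀ a, 0 ≤ a → 0 ≤ (f a).re ∧ (f a).im = 0) ∧ (∀ j ∈ J, f j = 0) ∧
      ‖c‖ ≤ (f c).re := by
  obtain ⟨g, hg, hg1⟩ := exists_dual_vector'' ℂ (J.mkQL (1 + c))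
  have hN : 1 + ‖c‖ ≤ ‖J.mkQL (1 + c)‖ := by
    refine le_of_forall_pos_le_add fun ε hε => ?_
    obtain ⟨m, hm, hm'⟩ := Submodule.Quotient.norm_mk_lt (J.mkQL (1 + c)) hε
    have : m - (1 + c) ∈ J := (Submodule.Quotient.eq J).1 hm
    have := hJ _ this
    rw [add_sub_cancel] at this
    exact this.trans hm'.le
  let f : W →L[ℂ] ℂ := g.comp J.mkQL
  have hf : ‖f‖ ≤ 1 := f.opNorm_le_bound zero_le_one fun x => by
    refine (g.le_of_opNorm_le hg _).trans ?_
    gcongr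
    exact Submodule.Quotient.norm_mk_le J x
  have hf1 : ‖f 1‖ ≤ 1 := by simpa using f.le_of_opNorm_le hf 1
  have hfc : ‖f c‖ ≤ ‖c‖ := by simpa using f.le_of_opNorm_le hf c
  have hs : (f 1).re + (f c).re = ‖J.mkQL (1 + c)‖ := by
    have := congrArg Complex.re hg1
    rw [← Complex.add_re, ← map_add]
    exact this
  have h1 := Complex.re_le_norm (f 1)
  have h2 := Complex.re_le_norm (f c)
  have h11 : f 1 = 1 := by
    have hre : (f 1).re = 1 := by linarith
    have hsq : ‖f 1‖ ^ 2 ≤ 1 := pow_le_one₀ (norm_nonneg _) hf1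
    rw [← Complex.normSq_eq_norm_sq, Complex.normSq_apply, hre] at hsq
    refine Complex.ext hre ?_
    rw [Complex.one_im]
    nlinarith
  refine ⟨f, fun a ha => ?_, fun j hj => ?_, by linarith⟩
  · have := Complex.nonneg_iff.1 (nonneg_apply_of_norm_le_one f hf h11 ha)
    exact ⟨this.1, this.2.symm⟩
  · have : J.mkQL j = 0 := (Submodule.Quotient.mk_eq_zero J).2 hj
    change g (J.mkQL j) = 0
    rw [this, map_zero]

open scoped ComplexOrder in
/-- A representation that vanishes on an ideal `J` but not at `d`, provided that
`star d * d` keeps its norm modulo `J` in the strong sense of `hd`. -/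
theorem exists_rep_of_le_norm {W : Type u} [CStarAlgebra W] [Nontrivial W] (J : Submodule ℂ W)
    (hJ : ∀ j ∈ J, ∀ x y, x * j * y ∈ J) {d : W} (hd0 : d ≠ 0)
    (hd : ∀ j ∈ J, 1 + ‖star d * d‖ ≤ ‖1 + star d * d + j‖) :
    ∃ (H : Type u) (_ : NormedAddCommGroup H) (_ : InnerProductSpace ℂ H) (_ : CompleteSpace H)
      (Θ : W →⋆ₙₐ[ℂ] (H →L[ℂ] H)), (∀ j ∈ J, Θ j = 0) ∧ Θ d ≠ 0 := by
  let _ : PartialOrder W := CStarAlgebra.spectralOrder W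
  have _ : StarOrderedRing W := CStarAlgebra.spectralOrderedRing W
  obtain ⟨f, hf, hfJ, hfd⟩ := exists_state_of_le_norm J hd
  let F : W →ₚ[ℂ] ℂ := PositiveLinearMap.mk₀ f.toLinearMap fun a ha =>
    Complex.nonneg_iff.2 ⟨(hf a ha).1, (hf a ha).2.symm⟩
  have hn (a b : W) : ‖F.toPreGNS (a * b)‖ ^ 2 = (f (star b * (star a * a) * b)).re := by
    have := congrArg Complex.re (F.preGNS_norm_sq (F.toPreGNS (a * b)))
    rw [← Complex.ofReal_pow, Complex.ofReal_re] at this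
    rw [this, PositiveLinearMap.ofPreGNS_toPreGNS, star_mul]
    simp only [mul_assoc]
    rfl
  refine ⟨F.GNS, inferInstance, inferInstance, inferInstance, F.gnsNonUnitalStarAlgHom,
    fun j hj => ?_, fun h => ?_⟩
  · ext b
    induction b using UniformSpace.Completion.induction_on with
    | hp => apply isClosed_eq <;> fun_prop
    | ih b =>
      rw [PositiveLinearMap.gnsNonUnitalStarAlgHom_apply_coe,
        PositiveLinearMap.leftMulMapPreGNS_apply, zero_apply]
      rw [← norm_eq_zero, UniformSpace.Completion.norm_coe, ← sq_eq_zero_iff]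
      refine (hn j (F.ofPreGNS b)).trans ?_
      -- The squared norm of `Θ j b` is `f (b* j* j b)`, whose argument lies in the two-sided ideal.
      rw [← mul_assoc, mul_assoc, mul_assoc, ← mul_assoc, hfJ _ ?_, Complex.zero_re]
      have := hJ j hj (star (F.ofPreGNS b) * star j) (F.ofPreGNS b)
      simpa only [mul_assoc] using this
  -- At the class of `1` the squared norm is `f (d* d)`, whose real part is at least `‖d‖² > 0`.
  · have h1 := congrArg (fun T => T (F.toPreGNS 1 : F.GNS)) h
    rw [PositiveLinearMap.gnsNonUnitalStarAlgHom_apply_coe,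
      PositiveLinearMap.leftMulMapPreGNS_apply, zero_apply,
      ← norm_eq_zero, UniformSpace.Completion.norm_coe, ← sq_eq_zero_iff] at h1
    have h2 := (hn d 1).symm.trans h1
    rw [star_one, one_mul, mul_one] at h2
    rw [h2, CStarRing.norm_star_mul_self] at hfd
    have := norm_pos_iff.2 hd0
    nlinarith

/-! ### Covariant families from bounded families modulo tails. -/

namespace TailRep

open scoped ENNReal

variable {A : Type u} [CStarAlgebra A] {S : Type v} [Monoid S] {G : Type*} [Group G]

noncomputable instance [Nontrivial A] : CStarAlgebra (lp (fun _ : S => A) ∞) where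

/-- Bounded families that vanish on a tail `{v * u | v}` of the monoid. -/
def vanishing (A : Type u) [CStarAlgebra A] (hOre : LeftOre S) :
    Submodule ℂ (lp (fun _ : S => A) ∞) where
  carrier := {w | ∃ u, ∀ v, w (v * u) = 0}
  zero_mem' := ⟨1, fun v => rfl⟩
  add_mem' := by
    rintro w w' ⟨u, hu⟩ ⟨u', hu'⟩
    obtain ⟨s, s', h⟩ := hOre u' u
    refine ⟨s * u, fun v => ?_⟩
    rw [lp.coeFn_add, Pi.add_apply, ← mul_assoc, hu, mul_assoc, h, ← mul_assoc, hu', add_zero]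
  smul_mem' := by
    rintro c w ⟨u, hu⟩
    exact ⟨u, fun v => by rw [lp.coeFn_smul, Pi.smul_apply, hu, smul_zero]⟩

theorem mul_mul_mem_vanishing (hOre : LeftOre S) {w : lp (fun _ : S => A) ∞}
    (hw : w ∈ vanishing A hOre) (x y : lp (fun _ : S => A) ∞) : x * w * y ∈ vanishing A hOre := by
  obtain ⟨u, hu⟩ := hw
  refine ⟨u, fun v => ?_⟩
  rw [lp.infty_coeFn_mul, lp.infty_coeFn_mul, Pi.mul_apply, Pi.mul_apply, hu, mul_zero, zero_mul]

variable (α : S →* (A →⋆ₙₐ[ℂ] A)) (η : S →* G)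

open Classical in
/-- The endomorphism `α_q` for `η q * g = η r`, and zero if there is no such `q`. -/
noncomputable def coord (g : G) (r : S) : A →⋆ₙₐ[ℂ] A :=
  if h : ∃ q, η q * g = η r then α h.choose else 0

variable {α η}

/-- Injectivity of `α w` cancels it on the left, so `α t` depends only on `η t`. This makes `coord`
independent of the chosen `q`. -/
theorem endo_congr (hα : ∀ s, Function.Injective (α s)) {t u w : S} (h : w * t = w * u) :
    α t = α u := by
  ext a
  have := congrArg (fun k => α k a) h
  simp only [map_mul] at this
  exact hα w this

theorem coord_eq (hα : ∀ s, Function.Injective (α s))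
    (hη : ∀ t u, η t = η u → ∃ w, w * t = w * u) {g : G} {r q : S} (h : η q * g = η r) :
    coord α η g r = α q := by
  have hex : ∃ q, η q * g = η r := ⟨q, h⟩
  rw [coord, dif_pos hex]
  obtain ⟨w, hw⟩ := hη _ _ (mul_right_cancel (hex.choose_spec.trans h.symm))
  exact endo_congr hα hw

variable (α η) in
/-- The *-homomorphism to bounded families with coordinates `coord α η g`. -/
noncomputable def family (g : G) : A →⋆ₙₐ[ℂ] lp (fun _ : S => A) ∞ where
  toFun a := ⟨fun r => coord α η g r a, memℓp_infty ⟨‖a‖, by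
    rintro _ ⟨r, rfl⟩
    exact NonUnitalStarAlgHom.norm_apply_le (coord α η g r) a⟩⟩
  map_smul' c a := by ext r; exact map_smul (coord α η g r) c a
  map_zero' := by ext r; exact map_zero (coord α η g r)
  map_add' a b := by ext r; exact map_add (coord α η g r) a b
  map_mul' a b := by ext r; exact map_mul (coord α η g r) a b
  map_star' a := by ext r; exact map_star (coord α η g r) a

theorem family_apply (g : G) (a : A) (r : S) : family α η g a r = coord α η g r a := rfl

/-- If `η x * (η s * g) = η y`, then at each `v * y` the two coordinates are `α_{vx}(α_s a)` and
`α_{vxs}(a)`, which agree. Thus covariance holds exactly modulo the tail ideal. -/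
theorem family_sub_mem_vanishing (hOre : LeftOre S) (hα : ∀ s, Function.Injective (α s))
    (hη : ∀ t u, η t = η u → ∃ w, w * t = w * u) (hη' : ∀ g, ∃ x y, η x * g = η y)
    (s : S) (g : G) (a : A) :
    family α η (η s * g) (α s a) - family α η g a ∈ vanishing A hOre := by
  obtain ⟨x, y, h⟩ := hη' (η s * g)
  refine ⟨y, fun v => ?_⟩
  rw [lp.coeFn_sub, Pi.sub_apply, family_apply, family_apply,
    coord_eq hα hη (q := v * x) (by rw [map_mul, mul_assoc, h, map_mul]),
    coord_eq hα hη (q := v * x * s)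
      (by rw [map_mul, map_mul, mul_assoc, mul_assoc, h, map_mul]), map_mul α (v * x) s]
  exact sub_self _

/-- The Ore condition puts a point `p * u = q * t` on the tail where `j` vanishes. The coordinate
there is `α q`, an isometry by injectivity, so this one coordinate already has norm at least `1 +
‖c* c‖`. -/
theorem one_add_norm_le_of_mem_vanishing [Nontrivial A] (hOre : LeftOre S)
    (hα : ∀ s, Function.Injective (α s)) (hη : ∀ t u, η t = η u → ∃ w, w * t = w * u) (t : S)
    (c : A) {j : lp (fun _ : S => A) ∞} (hj : j ∈ vanishing A hOre) :
    1 + ‖star (family α η (η t) c) * family α η (η t) c‖ ≤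
      ‖1 + star (family α η (η t) c) * family α η (η t) c + j‖ := by
  let _ : PartialOrder A := CStarAlgebra.spectralOrder A
  have _ : StarOrderedRing A := CStarAlgebra.spectralOrderedRing A
  obtain ⟨u, hu⟩ := hj
  obtain ⟨q, p, h⟩ := hOre u t
  have hq : coord α η (η t) (p * u) = α q := coord_eq hα hη (by rw [← map_mul, h])
  rw [← map_star, ← map_mul]
  have h1 := lp.norm_apply_le_norm ENNReal.top_ne_zero
    (1 + family α η (η t) (star c * c) + j) (p * u)
  rw [lp.coeFn_add, Pi.add_apply, lp.coeFn_add, Pi.add_apply, hu, add_zero, lp.infty_coeFn_one,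
    Pi.one_apply, family_apply, hq] at h1
  have h2 : 0 ≤ α q (star c * c) := by
    rw [map_mul, map_star]
    exact star_mul_self_nonneg _
  have h3 := one_add_norm_le_norm_one_add h2
  rw [NonUnitalStarAlgHom.norm_map (α q) (hα q)] at h3
  have h4 := NonUnitalStarAlgHom.norm_apply_le (family α η (η t)) (star c * c)
  linarith

theorem family_ne_zero (hα : ∀ s, Function.Injective (α s))
    (hη : ∀ t u, η t = η u → ∃ w, w * t = w * u) (t : S) {c : A} (hc : c ≠ 0) :
    family α η (η t) c ≠ 0 := by
  intro h
  have h1 := family_apply (α := α) (η := η) (η t) c t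
  rw [h, coord_eq hα hη (q := 1) (by rw [map_one, one_mul]), map_one α] at h1
  exact hc h1.symm

/-- A covariant family of representations indexed by the group of fractions that is nonzero
at a given element. -/
theorem exists_covariant_family (hOre : LeftOre S) (hα : ∀ s, Function.Injective (α s))
    (hη : ∀ t u, η t = η u → ∃ w, w * t = w * u) (hη' : ∀ g, ∃ x y, η x * g = η y) (t : S) {c : A}
    (hc : c ≠ 0) :
    ∃ (L : Type (max u v)) (_ : NormedAddCommGroup L) (_ : InnerProductSpace ℂ L)
      (_ : CompleteSpace L) (R : G → A →⋆ₙₐ[ℂ] (L →L[ℂ] L)),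
      (∀ s g a, R (η s * g) (α s a) = R g a) ∧ R (η t) c ≠ 0 := by
  have : Nontrivial A := ⟨⟨c, 0, hc⟩⟩
  have : Nontrivial (lp (fun _ : S => A) ∞) := ⟨⟨_, 0, family_ne_zero hα hη t hc⟩⟩
  obtain ⟨L, i1, i2, i3, Θ, hJ, hΘ⟩ := exists_rep_of_le_norm (vanishing A hOre)
    (fun j hj x y => mul_mul_mem_vanishing hOre hj x y) (family_ne_zero hα hη t hc)
    (fun j hj => one_add_norm_le_of_mem_vanishing hOre hα hη t c hj)
  refine ⟨L, i1, i2, i3, fun g => Θ.comp (family α η g), fun s g a => ?_, hΘ⟩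
  have := hJ _ (family_sub_mem_vanishing hOre hα hη hη' s g a)
  rw [map_sub, sub_eq_zero] at this
  exact this

end TailRep

/-! ### Separation of points. -/

namespace FracSkew

variable {A : Type u} [CStarAlgebra A] {S : Type v} [Monoid S] {α : S →* (A →⋆ₙₐ[ℂ] A)}
  {G : Type*} [Group G] {η : S →* G}

/-- Because `s₋ = s₋ s₊ s₋ = s₋ φ(α_s(1))` and `t₊ = t₊ t₋ t₊ = φ(α_t(1)) t₊`. Only the cut-down
coefficient matters, and it is what the regular representation detects. -/
theorem coeff_compress (s t : S) (a : A) :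
    neg α (.op s) * (coeff α a * pos α t) =
      neg α (.op s) * (coeff α (α s 1 * a * α t 1) * pos α t) := by
  rw [map_mul, map_mul, ← pos_mul_neg, ← pos_mul_neg]
  simp only [mul_assoc]
  rw [neg_mul_pos, mul_one, ← mul_assoc (neg α _) (pos α s), neg_mul_pos, one_mul]

theorem exists_compress_ne_zero {s : S} {f : Set.range η →₀ A}
    (h : neg α (.op s) * rangeSum α η f ≠ 0) :
    ∃ g, α s 1 * f g * α g.2.choose 1 ≠ 0 := by
  by_contra! hf
  refine h ?_
  have : rangeSum α η f = ∑ g ∈ f.support, coeff α (f g) * pos α g.2.choose := rfl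
  rw [this, Finset.mul_sum]
  refine Finset.sum_eq_zero fun g _ => ?_
  rw [coeff_compress, hf, map_zero, zero_mul, mul_zero]

open RegularRep in
open Classical in
-- The term indexed by `k` moves a vector supported at `1` to `k`, so only `k = g` contributes at
-- `g`. The factor `α_t(1)` appears because `R 1 1 = R (η t) (α_t(1))`.
theorem ofPair_rangeSum_apply {L : Type*} [NormedAddCommGroup L] [InnerProductSpace ℂ L]
    [CompleteSpace L] {R : G → A →⋆ₙₐ[ℂ] (L →L[ℂ] L)}
    (hR : ∀ s g a, R (η s * g) (α s a) = R g a) (b : A) (f : Set.range η →₀ A) (ζ : L)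
    (g : Set.range η) :
    (ofPair (isCovariantPair hR) (coeff α b * rangeSum α η f) (single R 1 ζ)).1 g.1 =
      R g.1 (b * f g * α g.2.choose 1) ζ := by
  let E : (space R →L[ℂ] space R) →+ L :=
    { toFun := fun T => (T (single R 1 ζ)).1 g.1
      map_zero' := rfl
      map_add' := fun _ _ => rfl }
  have hη (k : Set.range η) : η k.2.choose = k.1 := k.2.choose_spec
  have hsum : rangeSum α η f = ∑ k ∈ f.support, coeff α (f k) * pos α k.2.choose := rfl
  have hk (k : Set.range η) : E (ofPair (isCovariantPair hR)
      (coeff α b * (coeff α (f k) * pos α k.2.choose))) =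
      R g.1 (b * f k) ((single R 1 ζ).1 (k.1⁻¹ * g.1)) := by
    have h : E (diag R (b * f k) * shift hR k.2.choose) =
        R g.1 (b * f k) ((single R 1 ζ).1 ((η k.2.choose)⁻¹ * g.1)) := rfl
    rw [← mul_assoc, ← map_mul, map_mul, ofPair_coeff, ofPair_pos, h, hη]
  change E _ = _
  rw [hsum, Finset.mul_sum, map_sum, map_sum, Finset.sum_eq_single g]
  · rw [hk, inv_mul_cancel]
    rw [single_apply_self, apply_mul _ (b * f g), ← hR g.2.choose 1 1, hη, mul_one]
  · intro k _ hkg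
    rw [hk]
    have : k.1⁻¹ * g.1 ≠ 1 := fun h => hkg (Subtype.ext (inv_mul_eq_one.1 h))
    rw [single_apply_ne _ this, map_zero]
  · intro hg
    rw [hk, Finsupp.notMem_support_iff.1 hg, mul_zero, map_zero]
    rfl

/-- Covariant representations separate the points of `S^op *_α A *_α S`. -/
theorem exists_covariantPair_ne_zero (hOre : LeftOre S) (hrev : LeftReversible S)
    (hα : ∀ s, Function.Injective (α s)) {x : FracSkew α} (hx : x ≠ 0) :
    ∃ (H : Type (max u v)) (_ : NormedAddCommGroup H) (_ : InnerProductSpace ℂ H)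
      (_ : CompleteSpace H) (π : A →⋆ₐ[ℂ] (H →L[ℂ] H)) (V : S →* (H →L[ℂ] H))
      (h : IsCovariantPair α π V), ofPair h x ≠ 0 := by
  classical
  obtain ⟨G, _, η, hη, hη'⟩ := exists_group_of_left_fractions hOre hrev
  obtain ⟨s, f, rfl⟩ := exists_eq_neg_mul_rangeSum hOre hη x
  obtain ⟨g, hg⟩ := exists_compress_ne_zero hx
  obtain ⟨L, _, _, _, R, hR, hRc⟩ :=
    TailRep.exists_covariant_family hOre hα hη hη' g.2.choose hg
  obtain ⟨ζ, hζ⟩ : ∃ ζ, R (η g.2.choose) (α s 1 * f g * α g.2.choose 1) ζ ≠ 0 := by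
    by_contra! h
    exact hRc (ContinuousLinearMap.ext h)
  rw [g.2.choose_spec] at hζ
  refine ⟨RegularRep.space R, inferInstance, inferInstance, inferInstance, RegularRep.diag R,
    RegularRep.shift hR, RegularRep.isCovariantPair hR, fun h => hζ ?_⟩
  -- Left multiplication by `s₊` turns `s₋` into `φ(α_s(1))`, so the detected entry is zero if the
  -- image of the element is.
  rw [← ofPair_rangeSum_apply hR, ← pos_mul_neg, mul_assoc, map_mul, h, mul_zero]
  rfl

end FracSkew

/-! ### Completion of a pre-C*-algebra. -/

section CStarCompletion

open UniformSpace

variable {E : Type*} [NormedRing E] [StarRing E] [CStarRing E]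

noncomputable instance : Star (Completion E) := ⟨Completion.map star⟩

theorem completion_coe_star (x : E) : ((star x : E) : Completion E) = star (x : Completion E) :=
  (Completion.map_coe (star_isometry (E := E)).uniformContinuous x).symm

instance : ContinuousStar (Completion E) := ⟨Completion.continuous_map⟩

noncomputable instance : StarRing (Completion E) where
  star_involutive x := by
    induction x using Completion.induction_on with
    | hp => exact isClosed_eq (by fun_prop) continuous_id
    | ih x => rw [← completion_coe_star, ← completion_coe_star, star_star]
  star_mul x y := by
    induction x, y using Completion.induction_on₂ with
    | hp => apply isClosed_eq <;> fun_prop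
    | ih x y =>
      rw [← Completion.coe_mul, ← completion_coe_star, ← completion_coe_star,
        ← completion_coe_star, ← Completion.coe_mul, star_mul]
  star_add x y := by
    induction x, y using Completion.induction_on₂ with
    | hp => apply isClosed_eq <;> fun_prop
    | ih x y =>
      rw [← Completion.coe_add, ← completion_coe_star, ← completion_coe_star,
        ← completion_coe_star, ← Completion.coe_add, star_add]

instance : CStarRing (Completion E) where
  norm_mul_self_le x := by
    induction x using Completion.induction_on with
    | hp => apply isClosed_le <;> fun_prop
    | ih x =>
      rw [← completion_coe_star, ← Completion.coe_mul, Completion.norm_coe, Completion.norm_coe]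
      exact CStarRing.norm_mul_self_le x

variable [NormedAlgebra ℂ E] [StarModule ℂ E]

instance : StarModule ℂ (Completion E) where
  star_smul c x := by
    induction x using Completion.induction_on with
    | hp =>
      exact isClosed_eq (continuous_star.comp (continuous_const_smul c))
        ((continuous_const_smul (star c)).comp continuous_star)
    | ih x =>
      have h : ((star (c • x) : E) : Completion E) = ((star c • star x : E) : Completion E) := by
        rw [star_smul]
      rw [completion_coe_star, Completion.coe_smul, Completion.coe_smul,
        completion_coe_star] at h
      exact h

noncomputable instance : CStarAlgebra (Completion E) where
  norm_smul_le := norm_smul_le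

/-- The inclusion into the completion as a *-homomorphism. -/
noncomputable def toCompletionStarAlgHom (E : Type*) [NormedRing E] [StarRing E] [CStarRing E]
    [NormedAlgebra ℂ E] [StarModule ℂ E] : E →⋆ₐ[ℂ] Completion E :=
  { (Completion.coeRingHom : E →+* Completion E) with
    commutes' := fun _ => rfl
    map_star' := completion_coe_star }

theorem denseRange_toCompletionStarAlgHom : DenseRange (toCompletionStarAlgHom E) :=
  Completion.denseRange_coe

/-- The extension of a continuous *-homomorphism to the completion. -/
noncomputable def completionLift {D : Type*} [CStarAlgebra D] (f : E →⋆ₐ[ℂ] D)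
    (hf : Continuous f) : Completion E →⋆ₐ[ℂ] D :=
  let F : Completion E →+* D := Completion.extensionHom (f : E →+* D) hf
  have hF (x : E) : F x = f x := Completion.extensionHom_coe (f : E →+* D) hf x
  have hc : Continuous F := Completion.continuous_extension
  { F with
    commutes' := fun c => (hF _).trans (AlgHomClass.commutes f c)
    map_star' := fun x => by
      change F (star x) = star (F x)
      induction x using Completion.induction_on with
      | hp => exact isClosed_eq (by fun_prop) (by fun_prop)
      | ih x => rw [← completion_coe_star, hF, hF, map_star] }

theorem completionLift_coe {D : Type*} [CStarAlgebra D] (f : E →⋆ₐ[ℂ] D)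
    (hf : Continuous f) (x : E) : completionLift f hf (toCompletionStarAlgHom E x) = f x :=
  Completion.extensionHom_coe (f : E →+* D) hf x

end CStarCompletion

/-! ### The maximal C*-norm and the crossed product. -/

namespace FracSkew

variable {A : Type u} [CStarAlgebra A] {S : Type v} [Monoid S] {α : S →* (A →⋆ₙₐ[ℂ] A)}

/-- The norms of `x` in the covariant representations. -/
def repNorms (x : FracSkew α) : Set ℝ :=
  {r | ∃ (H : Type (max u v)) (_ : NormedAddCommGroup H) (_ : InnerProductSpace ℂ H)
    (_ : CompleteSpace H) (π : A →⋆ₐ[ℂ] (H →L[ℂ] H)) (V : S →* (H →L[ℂ] H))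
    (h : IsCovariantPair α π V), r = ‖ofPair h x‖}

theorem _root_.IsCovariantPair.norm_le_one {D : Type*} [CStarAlgebra D] {π : A →⋆ₐ[ℂ] D}
    {V : S →* D} (h : IsCovariantPair α π V) (s : S) : ‖V s‖ ≤ 1 := by
  have h1 : ‖V s‖ * ‖V s‖ ≤ 1 := by
    rw [← CStarRing.norm_star_mul_self, h.isometry]
    rcases subsingleton_or_nontrivial D with hD | hD
    · rw [Subsingleton.elim (1 : D) 0, norm_zero]
      exact zero_le_one
    · exact CStarRing.norm_one.le
  nlinarith [norm_nonneg (V s)]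

theorem bddAbove_repNorms (x : FracSkew α) : BddAbove (repNorms x) := by
  -- A constant independent of the representation is the form that passes through sums and products
  -- in the induction.
  suffices h : ∃ C : ℝ, ∀ (H : Type (max u v)) [NormedAddCommGroup H] [InnerProductSpace ℂ H]
      [CompleteSpace H] (π : A →⋆ₐ[ℂ] (H →L[ℂ] H)) (V : S →* (H →L[ℂ] H))
      (h : IsCovariantPair α π V), ‖ofPair h x‖ ≤ C by
    obtain ⟨C, hC⟩ := h
    refine ⟨C, ?_⟩
    rintro _ ⟨H, _, _, _, π, V, h, rfl⟩
    exact hC H π V h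
  induction x using FracSkew.induction with
  | hn =>
    refine ⟨1, fun H _ _ _ π V h => ?_⟩
    rw [map_neg, map_one, norm_neg]
    exact ContinuousLinearMap.norm_id_le
  | hc a =>
    refine ⟨‖a‖, fun H _ _ _ π V h => ?_⟩
    rw [ofPair_coeff]
    exact NonUnitalStarAlgHom.norm_apply_le π a
  | hp t =>
    refine ⟨1, fun H _ _ _ π V h => ?_⟩
    rw [ofPair_pos]
    exact h.norm_le_one t
  | hm s =>
    refine ⟨1, fun H _ _ _ π V h => ?_⟩
    rw [ofPair_neg, norm_star]
    exact h.norm_le_one s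
  | hadd x y hx hy =>
    obtain ⟨C, hC⟩ := hx
    obtain ⟨C', hC'⟩ := hy
    refine ⟨C + C', fun H _ _ _ π V h => ?_⟩
    rw [map_add]
    exact (norm_add_le _ _).trans (add_le_add (hC H π V h) (hC' H π V h))
  | hmul x y hx hy =>
    obtain ⟨C, hC⟩ := hx
    obtain ⟨C', hC'⟩ := hy
    refine ⟨C * C', fun H _ _ _ π V h => ?_⟩
    rw [map_mul]
    exact (norm_mul_le _ _).trans (mul_le_mul (hC H π V h) (hC' H π V h) (norm_nonneg _)
      ((norm_nonneg _).trans (hC H π V h)))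

/-- The largest C*-norm. -/
noncomputable def maxNorm (x : FracSkew α) : ℝ := sSup (repNorms x)

theorem norm_ofPair_le_maxNorm {H : Type (max u v)} [NormedAddCommGroup H]
    [InnerProductSpace ℂ H] [CompleteSpace H] {π : A →⋆ₐ[ℂ] (H →L[ℂ] H)} {V : S →* (H →L[ℂ] H)}
    (h : IsCovariantPair α π V) (x : FracSkew α) : ‖ofPair h x‖ ≤ maxNorm x :=
  le_csSup (bddAbove_repNorms x) ⟨H, _, _, _, π, V, h, rfl⟩

theorem maxNorm_le {x : FracSkew α} {C : ℝ} (hC : 0 ≤ C)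
    (h : ∀ (H : Type (max u v)) [NormedAddCommGroup H] [InnerProductSpace ℂ H]
      [CompleteSpace H] (π : A →⋆ₐ[ℂ] (H →L[ℂ] H)) (V : S →* (H →L[ℂ] H))
      (h : IsCovariantPair α π V), ‖ofPair h x‖ ≤ C) : maxNorm x ≤ C := by
  -- As `sSup ∅ = 0` in `ℝ`, `0 ≤ C` spares a proof that the set of norms is nonempty.
  refine Real.sSup_le ?_ hC
  rintro _ ⟨H, _, _, _, π, V, hp, rfl⟩
  exact h H π V hp

theorem maxNorm_nonneg (x : FracSkew α) : 0 ≤ maxNorm x := by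
  refine Real.sSup_nonneg ?_
  rintro _ ⟨H, _, _, _, π, V, hp, rfl⟩
  exact norm_nonneg _

variable (α) in
/-- The largest C*-norm as a ring norm. -/
noncomputable def maxRingNorm (hOre : LeftOre S) (hrev : LeftReversible S)
    (hα : ∀ s, Function.Injective (α s)) : RingNorm (FracSkew α) where
  toFun := maxNorm
  map_zero' := le_antisymm (maxNorm_le le_rfl fun H _ _ _ π V h => by rw [map_zero, norm_zero])
    (maxNorm_nonneg 0)
  add_le' x y := maxNorm_le (add_nonneg (maxNorm_nonneg x) (maxNorm_nonneg y))
    fun H _ _ _ π V h => by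
      rw [map_add]
      exact (norm_add_le _ _).trans
        (add_le_add (norm_ofPair_le_maxNorm h x) (norm_ofPair_le_maxNorm h y))
  neg' x := by
    have key (x : FracSkew α) : maxNorm (-x) ≤ maxNorm x :=
      maxNorm_le (maxNorm_nonneg x) fun H _ _ _ π V h => by
        rw [map_neg, norm_neg]
        exact norm_ofPair_le_maxNorm h x
    exact le_antisymm (key x) (by simpa using key (-x))
  mul_le' x y := maxNorm_le (mul_nonneg (maxNorm_nonneg x) (maxNorm_nonneg y))
    fun H _ _ _ π V h => by
      rw [map_mul]
      exact (norm_mul_le _ _).trans (mul_le_mul (norm_ofPair_le_maxNorm h x)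
        (norm_ofPair_le_maxNorm h y) (norm_nonneg _) (maxNorm_nonneg x))
  eq_zero_of_map_eq_zero' x hx := by
    by_contra h0
    -- Separation of points is what makes the seminorm definite.
    obtain ⟨H, _, _, _, π, V, h, hne⟩ := exists_covariantPair_ne_zero hOre hrev hα h0
    exact hne (norm_le_zero_iff.1 ((norm_ofPair_le_maxNorm h x).trans_eq hx))

theorem maxNorm_smul_le (c : ℂ) (x : FracSkew α) : maxNorm (c • x) ≤ ‖c‖ * maxNorm x :=
  maxNorm_le (mul_nonneg (norm_nonneg c) (maxNorm_nonneg x)) fun H _ _ _ π V h => by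
    rw [map_smul, norm_smul]
    gcongr
    exact norm_ofPair_le_maxNorm h x

theorem maxNorm_mul_self_le (x : FracSkew α) : maxNorm x * maxNorm x ≤ maxNorm (star x * x) := by
  rw [← sq, ← Real.le_sqrt (maxNorm_nonneg _) (maxNorm_nonneg _)]
  refine maxNorm_le (Real.sqrt_nonneg _) fun H _ _ _ π V h => Real.le_sqrt_of_sq_le ?_
  rw [sq, ← CStarRing.norm_star_mul_self, ← map_star, ← map_mul]
  exact norm_ofPair_le_maxNorm h _

/-- The structure map `φ` as a *-homomorphism. -/
noncomputable def coeffStarAlgHom (α : S →* (A →⋆ₙₐ[ℂ] A)) : A →⋆ₐ[ℂ] FracSkew α :=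
  { coeff α with
    commutes' := fun _ => rfl
    map_star' := fun a => (star_coeff a).symm }

theorem apply_mem_adjoin {B : Type*} [CStarAlgebra B] (φ : FracSkew α →⋆ₐ[ℂ] B) (x : FracSkew α) :
    φ x ∈ StarAlgebra.adjoin ℂ
      (Set.range (fun a => φ (coeff α a)) ∪ Set.range fun s => φ (pos α s)) := by
  have hp (s : S) : φ (pos α s) ∈ StarAlgebra.adjoin ℂ
      (Set.range (fun a => φ (coeff α a)) ∪ Set.range fun s => φ (pos α s)) :=
    StarAlgebra.subset_adjoin ℂ _ (Or.inr ⟨s, rfl⟩)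
  induction x using FracSkew.induction with
  | hn => rw [map_neg, map_one]; exact neg_mem (one_mem _)
  | hc a => exact StarAlgebra.subset_adjoin ℂ _ (Or.inl ⟨a, rfl⟩)
  | hp t => exact hp t
  | hm s => rw [← star_pos, map_star]; exact star_mem (hp s)
  | hadd x y hx hy => rw [map_add]; exact add_mem hx hy
  | hmul x y hx hy => rw [map_mul]; exact mul_mem hx hy

theorem exists_isCrossedProduct (hOre : LeftOre S) (hrev : LeftReversible S)
    (hα : ∀ s, Function.Injective (α s)) :
    ∃ (B : Type (max u v)) (_ : CStarAlgebra B) (iA : A →⋆ₐ[ℂ] B) (iS : S →* B),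
      IsCrossedProduct α iA iS := by
  let _ : NormedRing (FracSkew α) := (maxRingNorm α hOre hrev hα).toNormedRing
  let _ : NormedAlgebra ℂ (FracSkew α) := ⟨maxNorm_smul_le⟩
  have _ : CStarRing (FracSkew α) := ⟨fun {x} => maxNorm_mul_self_le x⟩
  let j := toCompletionStarAlgHom (FracSkew α)
  let iA := j.comp (coeffStarAlgHom α)
  let iS : S →* UniformSpace.Completion (FracSkew α) := (j : FracSkew α →* _).comp (pos α)
  refine ⟨UniformSpace.Completion (FracSkew α), inferInstance, iA, iS,
    isCovariantPair_of_starAlgHom j iA iS (fun a => rfl) (fun s => rfl), ?_, ?_⟩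
  · intro H _ _ _ π V h
    have hc : Continuous (ofPair h) :=
      AddMonoidHomClass.continuous_of_bound (ofPair h) 1 fun x => by
        rw [one_mul]
        exact norm_ofPair_le_maxNorm h x
    exact ⟨completionLift (ofPair h) hc,
      fun a => (completionLift_coe _ hc _).trans (ofPair_coeff h a),
      fun s => (completionLift_coe _ hc _).trans (ofPair_pos h s)⟩
  · rw [eq_top_iff]
    intro x _
    have hx : x ∈ closure (Set.range j) := denseRange_toCompletionStarAlgHom x
    refine closure_mono ?_ hx
    rintro _ ⟨y, rfl⟩
    exact apply_mem_adjoin j y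

variable {B : Type w} [CStarAlgebra B] {iA : A →⋆ₐ[ℂ] B} {iS : S →* B}

/-- A covariant representation nonzero at `x` factors through the canonical map, which therefore
cannot kill `x`. -/
theorem injective_ofPair_of_isCrossedProduct (hOre : LeftOre S) (hrev : LeftReversible S)
    (hα : ∀ s, Function.Injective (α s)) (h : IsCrossedProduct α iA iS) :
    Function.Injective (ofPair h.isCovariantPair) := by
  rw [injective_iff_map_eq_zero]
  intro x hx
  by_contra h0
  obtain ⟨H, _, _, _, π, V, hp, hne⟩ := exists_covariantPair_ne_zero hOre hrev hα h0
  obtain ⟨ρ, hρA, hρS⟩ := h.exists_rep H π V hp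
  have : ρ.comp (ofPair h.isCovariantPair) = ofPair hp := starAlgHom_ext
    (fun a => by rw [StarAlgHom.comp_apply, ofPair_coeff, ofPair_coeff, hρA])
    (fun s => by rw [StarAlgHom.comp_apply, ofPair_pos, ofPair_pos, hρS])
  exact hne (by rw [← this, StarAlgHom.comp_apply, hx, map_zero])

theorem denseRange_ofPair_of_isCrossedProduct (h : IsCrossedProduct α iA iS) :
    DenseRange (ofPair h.isCovariantPair) := by
  have hle : StarAlgebra.adjoin ℂ (Set.range iA ∪ Set.range iS) ≤
      (ofPair h.isCovariantPair).range := by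
    refine StarAlgebra.adjoin_le ?_
    rintro _ (⟨a, rfl⟩ | ⟨s, rfl⟩)
    · exact ⟨coeff α a, ofPair_coeff _ a⟩
    · exact ⟨pos α s, ofPair_pos _ s⟩
  intro b
  have hb : b ∈ (StarAlgebra.adjoin ℂ (Set.range iA ∪ Set.range iS)).topologicalClosure := by
    rw [h.generates]
    trivial
  exact closure_mono hle hb

end FracSkew

theorem lemma4p1 {A : Type u} [CStarAlgebra A] {S : Type v} [Monoid S]
    (hOre : LeftOre S) (hrev : LeftReversible S)
    (α : S →* (A →⋆ₙₐ[ℂ] A)) (hα : ∀ s, Function.Injective (α s)) :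
    (∃ (B : Type (max u v)) (_ : CStarAlgebra B) (iA : A →⋆ₐ[ℂ] B) (iS : S →* B),
      IsCrossedProduct α iA iS) ∧
    ∀ (B : Type w) [CStarAlgebra B] (iA : A →⋆ₐ[ℂ] B) (iS : S →* B),
      IsCrossedProduct α iA iS →
      ∃ φ : FracSkew α →⋆ₐ[ℂ] B,
        ((∀ a, φ (FracSkew.coeff α a) = iA a) ∧ ∀ s, φ (FracSkew.pos α s) = iS s) ∧
        (∀ ψ : FracSkew α →⋆ₐ[ℂ] B,
          (∀ a, ψ (FracSkew.coeff α a) = iA a) → (∀ s, ψ (FracSkew.pos α s) = iS s) → ψ = φ) ∧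
        Function.Injective φ ∧ DenseRange φ := by
  refine ⟨FracSkew.exists_isCrossedProduct hOre hrev hα, fun B _ iA iS h =>
    ⟨FracSkew.ofPair h.isCovariantPair,
      ⟨FracSkew.ofPair_coeff _, FracSkew.ofPair_pos _⟩, fun ψ hA hS => ?_,
      FracSkew.injective_ofPair_of_isCrossedProduct hOre hrev hα h,
      FracSkew.denseRange_ofPair_of_isCrossedProduct h⟩⟩
  exact FracSkew.starAlgHom_ext (fun a => by rw [hA, FracSkew.ofPair_coeff])
    (fun s => by rw [hS, FracSkew.ofPair_pos])
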